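/- Let $H$ be a complex separable Hilbert space. Let $\mathcal S_4$ be the Schatten class of compact operators $A$ on $H$ whose singular values $\sigma_1(A),\sigma_2(A),\dots$ (the square roots of the eigenvalues of $A^*A$, repeated according to multiplicity) satisfy $\sum_i \sigma_i(A)^4<\infty$, with the norm $\|A\|_{\mathcal S_4}=\bigl(\sum_i\sigma_i(A)^4\bigr)^{1/4}$. Let $L_4=L_4((0,1),\mathbb R)$ with respect to Lebesgue measure. Then for any $A,B\in\mathcal S_4$ the real space $\operatorname{span}_{\mathbb R}\{A,B\}$ is contained in $\mathcal S_4$ and, with the $\mathcal S_4$ norm, embeds linearly and isometrically into $L_4$: there is an $\mathbb R$-linear map $T:\operatorname{span}_{\mathbb R}\{A,B\}\to L_4$ with $\|TX\|_{L_4}=\|X\|_{\mathcal S_4}$ for every $X\in\operatorname{span}_{\mathbb R}\{A,B\}$. -/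

import Mathlib

open MeasureTheory

/-- The eigenspace of the positive operator `A* A` for the eigenvalue `s ^ 2`. Its dimension is the
multiplicity of `s` as a singular value of `A`. -/
noncomputable def singularSpace {H : Type*} [NormedAddCommGroup H] [InnerProductSpace ℂ H] [CompleteSpace H]
    (A : H →L[ℂ] H) (s : ℝ) : Submodule ℂ H :=
  Module.End.eigenspace
    (((ContinuousLinearMap.adjoint A).comp A : H →L[ℂ] H) : Module.End ℂ H) ((s : ℂ) ^ 2)

/-- Index set of the nonzero singular values of a compact operator `A`: each `s > 0` occurs as often
as its (finite) multiplicity. -/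
def SingularIndex {H : Type*} [NormedAddCommGroup H] [InnerProductSpace ℂ H] [CompleteSpace H]
    (A : H →L[ℂ] H) : Type :=
  Σ s : {s : ℝ // 0 < s}, Fin (Module.finrank ℂ (singularSpace A s.1))

/-- The family of nonzero singular values of a compact operator, repeated according to
multiplicity. -/
def singularValue {H : Type*} [NormedAddCommGroup H] [InnerProductSpace ℂ H] [CompleteSpace H]
    (A : H →L[ℂ] H) (i : SingularIndex A) : ℝ :=
  i.1.1

/-- Membership in the Schatten class `S_p`: `A` is compact and its singular values are
`p`-summable. -/
def MemSchatten {H : Type*} [NormedAddCommGroup H] [InnerProductSpace ℂ H] [CompleteSpace H]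
    (p : ℝ) (A : H →L[ℂ] H) : Prop :=
  IsCompactOperator A ∧ Summable fun i : SingularIndex A => singularValue A i ^ p

/-- The Schatten norm `(∑ σ_i(A) ^ p) ^ (1 / p)`, meaningful for `A` in `S_p`. -/
noncomputable def schattenNorm {H : Type*} [NormedAddCommGroup H] [InnerProductSpace ℂ H]
    [CompleteSpace H] (p : ℝ) (A : H →L[ℂ] H) : ℝ :=
  (∑' i : SingularIndex A, singularValue A i ^ p) ^ (1 / p)

/-! The fourth power of the `S₄` norm of `X` is the squared Hilbert-Schmidt norm of `X* X`. For `X =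
x A + y B` this Gram operator is a quadratic form `G(x, y)` with values in a Hilbert space, and
`⟪G(u), G(v)⟫` has nonnegative real part, since positive operators have nonnegative Hilbert-Schmidt
product (`inner_gram_nonneg`).

Put `Q = ‖G‖²`, a binary quartic. The `s² t²` coefficient of `Q(s u + t v)` is a square plus `2
⟪G(u), G(v)⟫`, so the symmetric 4-linear form of `Q` is nonnegative at `(u, u, v, v)`
(`squarePairing_normQuarticCoeff`). Thus the functional `c` that `Q` defines on quartics is
nonnegative on products of two squares of linear forms.

This is enough for `c` to come from a measure on the circle. By Hahn-Banach (`mem_circleMoments`),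
only nonnegativity on nonnegative quartics matters. Subtracting the minimum times `(u² + v²)²`
creates a real zero, necessarily double; the remaining quadratic factor is a sum of squares
(`pairing_nonneg_of_zero`). Transporting the measure to `(0, 1)` turns the two coordinates of the
circle into the required functions in `L₄`. -/

/-! ### Nonnegative binary quartics with a real zero -/

/-- The coefficients of `(α u + β v) ^ 2 * (γ u + δ v) ^ 2` as a quartic form in `u, v`, paired
with the sequence `c`. -/
def squarePairing (c : Fin 5 → ℝ) (α β γ δ : ℝ) : ℝ :=
  (α ^ 2 * γ ^ 2) * c 0 + (2 * α ^ 2 * γ * δ + 2 * α * β * γ ^ 2) * c 1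
    + (α ^ 2 * δ ^ 2 + 4 * α * β * γ * δ + β ^ 2 * γ ^ 2) * c 2
    + (2 * α * β * δ ^ 2 + 2 * β ^ 2 * γ * δ) * c 3 + (β ^ 2 * δ ^ 2) * c 4

/-- The binary quartic form with coefficients `a`. -/
def quarticForm (a : Fin 5 → ℝ) (u v : ℝ) : ℝ :=
  a 0 * u ^ 4 + a 1 * (u ^ 3 * v) + a 2 * (u ^ 2 * v ^ 2) + a 3 * (u * v ^ 3) + a 4 * v ^ 4

/-- Completing the square: the quadratic is `(p₁ x + p₂)² + (p₃ x)²`. -/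
lemma exists_sq_add_sq_of_nonneg {p q r : ℝ} (h : ∀ x, 0 ≤ p * x ^ 2 + q * x + r) :
    ∃ p₁ p₂ p₃ : ℝ, p = p₁ ^ 2 + p₃ ^ 2 ∧ q = 2 * p₁ * p₂ ∧ r = p₂ ^ 2 := by
  have hd : q ^ 2 ≤ 4 * p * r := by
    have := discrim_le_zero (a := p) (b := q) (c := r) (fun x => by nlinarith [h x])
    unfold discrim at this
    linarith
  have hr : 0 ≤ r := by simpa using h 0
  rcases hr.eq_or_lt with hr | hr
  · have hq : q = 0 := by
      rw [← hr] at hd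
      exact pow_eq_zero_iff two_ne_zero |>.1 (le_antisymm (by linarith) (sq_nonneg q))
    have hp : 0 ≤ p := by
      have := h 1
      rw [hq, ← hr] at this
      linarith
    exact ⟨0, 0, √p, by rw [Real.sq_sqrt hp]; ring, by simp [hq], by rw [← hr]; ring⟩
  · have hs : 0 < √r := Real.sqrt_pos.2 hr
    have hsq : √r ^ 2 = r := Real.sq_sqrt hr.le
    have hp : 0 ≤ p - q ^ 2 / (4 * r) := by
      rw [sub_nonneg, div_le_iff₀ (by positivity)]
      linarith
    refine ⟨q / (2 * √r), √r, √(p - q ^ 2 / (4 * r)), ?_, ?_, hsq.symm⟩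
    · rw [Real.sq_sqrt hp, div_pow, mul_pow, hsq]
      ring
    · field_simp

lemma quarticForm_rotate (a : Fin 5 → ℝ) (α β : ℝ) :
    ∃ g : Fin 5 → ℝ, ∀ x y,
      quarticForm a (α * x - β * y) (β * x + α * y) = quarticForm g x y := by
  refine ⟨![quarticForm a α β,
    -4*a 0*α^3*β + a 1*α^4 - 3*a 1*α^2*β^2 + 2*a 2*α^3*β - 2*a 2*α*β^3
      + 3*a 3*α^2*β^2 - a 3*β^4 + 4*a 4*α*β^3,
    6*a 0*α^2*β^2 - 3*a 1*α^3*β + 3*a 1*α*β^3 + a 2*α^4 - 4*a 2*α^2*β^2 + a 2*β^4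
      + 3*a 3*α^3*β - 3*a 3*α*β^3 + 6*a 4*α^2*β^2,
    -4*a 0*α*β^3 + 3*a 1*α^2*β^2 - a 1*β^4 - 2*a 2*α^3*β + 2*a 2*α*β^3
      + a 3*α^4 - 3*a 3*α^2*β^2 + 4*a 4*α^3*β,
    quarticForm a (-β) α], fun x y => ?_⟩
  simp [quarticForm, Fin.isValue]
  ring

/-- A nonnegative binary quartic form with a nontrivial real zero pairs nonnegatively with `c`. -/
lemma pairing_nonneg_of_zero {c a : Fin 5 → ℝ} (hc : ∀ α β γ δ, 0 ≤ squarePairing c α β γ δ)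
    (ha : ∀ u v, 0 ≤ quarticForm a u v) {α β : ℝ} (h1 : α ^ 2 + β ^ 2 = 1)
    (h0 : quarticForm a α β = 0) : 0 ≤ ∑ k, a k * c k := by
  obtain ⟨g, hg⟩ := quarticForm_rotate a α β
  have hgn : ∀ x y, 0 ≤ quarticForm g x y := fun x y => hg x y ▸ ha _ _
  have hg0 : g 0 = 0 := by
    have := hg 1 0
    simp only [mul_one, mul_zero, sub_zero, add_zero, h0] at this
    simpa [quarticForm] using this.symm
  -- The zero, now rotated to `(1, 0)`, is a minimum, so it is double and `y²` divides `g`.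
  have hg1 : g 1 = 0 := by
    have hd : HasDerivAt (fun y : ℝ => quarticForm g 1 y) (g 1) 0 := by
      have h : HasDerivAt (fun y : ℝ => g 0 + g 1 * y + g 2 * y ^ 2 + g 3 * y ^ 3 + g 4 * y ^ 4)
          (0 + g 1 * 1 + g 2 * (2 * (0 : ℝ) ^ 1 * 1) + g 3 * (3 * (0 : ℝ) ^ 2 * 1)
            + g 4 * (4 * (0 : ℝ) ^ 3 * 1)) 0 :=
        ((((hasDerivAt_const _ _).add ((hasDerivAt_id _).const_mul _)).add
          (((hasDerivAt_id _).pow 2).const_mul _)).add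
          (((hasDerivAt_id _).pow 3).const_mul _)).add (((hasDerivAt_id _).pow 4).const_mul _)
      convert h using 1
      · ext y
        simp [quarticForm]
      · simp
    have hmin : IsLocalMin (fun y : ℝ => quarticForm g 1 y) 0 := by
      refine Filter.Eventually.of_forall fun y => ?_
      have : quarticForm g 1 0 = 0 := by simp [quarticForm, hg0]
      simpa [this] using hgn 1 y
    exact hmin.hasDerivAt_eq_zero hd
  obtain ⟨p₁, p₂, p₃, e2, e3, e4⟩ := exists_sq_add_sq_of_nonneg (p := g 2) (q := g 3) (r := g 4)
    (fun x => by simpa [quarticForm, hg0, hg1] using hgn x 1)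
  have hF : ∀ u v, quarticForm a u v =
      ((-β * u + α * v) * ((p₁ * α - p₂ * β) * u + (p₁ * β + p₂ * α) * v)) ^ 2
        + ((-β * u + α * v) * (p₃ * α * u + p₃ * β * v)) ^ 2 := by
    intro u v
    have hu : α * (α * u + β * v) - β * (-β * u + α * v) = u := by linear_combination u * h1
    have hv : β * (α * u + β * v) + α * (-β * u + α * v) = v := by linear_combination v * h1
    have := hg (α * u + β * v) (-β * u + α * v)
    rw [hu, hv] at this
    rw [this]
    simp only [quarticForm, hg0, hg1, e2, e3, e4]
    ring
  -- Values at five pairwise non-proportional points determine the coefficients of a quartic form.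
  have f1 := hF 1 0
  have f2 := hF 0 1
  have f3 := hF 1 1
  have f4 := hF 1 (-1)
  have f5 := hF 1 2
  simp only [quarticForm] at f1 f2 f3 f4 f5
  have k1 := hc (-β) α (p₁ * α - p₂ * β) (p₁ * β + p₂ * α)
  have k2 := hc (-β) α (p₃ * α) (p₃ * β)
  unfold squarePairing at k1 k2
  have a0 : a 0 = (-β) ^ 2 * (p₁ * α - p₂ * β) ^ 2 + (-β) ^ 2 * (p₃ * α) ^ 2 := by
    linear_combination f1
  have a4 : a 4 = α ^ 2 * (p₁ * β + p₂ * α) ^ 2 + α ^ 2 * (p₃ * β) ^ 2 := by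
    linear_combination f2
  have a2 : a 2 = ((-β) ^ 2 * (p₁ * β + p₂ * α) ^ 2
      + 4 * (-β) * α * (p₁ * α - p₂ * β) * (p₁ * β + p₂ * α) + α ^ 2 * (p₁ * α - p₂ * β) ^ 2)
      + ((-β) ^ 2 * (p₃ * β) ^ 2 + 4 * (-β) * α * (p₃ * α) * (p₃ * β)
      + α ^ 2 * (p₃ * α) ^ 2) := by
    linear_combination (f3 + f4) / 2 - a0 - a4
  have a3 : a 3 = (2 * (-β) * α * (p₁ * β + p₂ * α) ^ 2
        + 2 * α ^ 2 * (p₁ * α - p₂ * β) * (p₁ * β + p₂ * α))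
      + (2 * (-β) * α * (p₃ * β) ^ 2 + 2 * α ^ 2 * (p₃ * α) * (p₃ * β)) := by
    linear_combination (f5 - (f3 - f4) - a0 - 4 * a2 - 16 * a4) / 6
  have a1 : a 1 = (2 * (-β) ^ 2 * (p₁ * α - p₂ * β) * (p₁ * β + p₂ * α)
        + 2 * (-β) * α * (p₁ * α - p₂ * β) ^ 2)
      + (2 * (-β) ^ 2 * (p₃ * α) * (p₃ * β) + 2 * (-β) * α * (p₃ * α) ^ 2) := by
    linear_combination (f3 - f4) / 2 - a3
  rw [Fin.sum_univ_five, a0, a1, a2, a3, a4]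
  linarith

/-! ### Degree-four moments on the circle -/

/-- The degree-four monomials at a point of the unit circle. -/
noncomputable def circleMonomial (z : Metric.sphere (0 : ℂ) 1) (k : Fin 5) : ℝ :=
  (z : ℂ).re ^ (4 - (k : ℕ)) * (z : ℂ).im ^ (k : ℕ)

lemma continuous_circleMonomial (k : Fin 5) : Continuous fun z => circleMonomial z k := by
  unfold circleMonomial
  fun_prop

lemma circle_re_sq_add_im_sq (z : Metric.sphere (0 : ℂ) 1) :
    (z : ℂ).re ^ 2 + (z : ℂ).im ^ 2 = 1 := by
  have h : ‖(z : ℂ)‖ = 1 := mem_sphere_zero_iff_norm.1 z.2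
  have := Complex.normSq_eq_norm_sq (z : ℂ)
  rw [Complex.normSq_apply, h] at this
  linarith

lemma exists_circle_smul (u v : ℝ) :
    ∃ (r : ℝ) (z : Metric.sphere (0 : ℂ) 1), u = r * (z : ℂ).re ∧ v = r * (z : ℂ).im := by
  refine ⟨‖(⟨u, v⟩ : ℂ)‖, ⟨Complex.exp (Complex.arg ⟨u, v⟩ * Complex.I), ?_⟩, ?_, ?_⟩
  · rw [mem_sphere_zero_iff_norm, Complex.norm_exp_ofReal_mul_I]
  · rw [← Complex.re_ofReal_mul, Complex.norm_mul_exp_arg_mul_I]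
  · rw [← Complex.im_ofReal_mul, Complex.norm_mul_exp_arg_mul_I]

lemma quarticForm_smul (a : Fin 5 → ℝ) (r u v : ℝ) :
    quarticForm a (r * u) (r * v) = r ^ 4 * quarticForm a u v := by
  unfold quarticForm
  ring

lemma quarticForm_circle (a : Fin 5 → ℝ) (z : Metric.sphere (0 : ℂ) 1) :
    quarticForm a (z : ℂ).re (z : ℂ).im = ∑ k, a k * circleMonomial z k := by
  simp [Fin.sum_univ_five, quarticForm, circleMonomial]

lemma pairing_nonneg {c : Fin 5 → ℝ} (hc : ∀ α β γ δ, 0 ≤ squarePairing c α β γ δ)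
    (a : Fin 5 → ℝ) (r : ℝ) (hr : ∀ z, r ≤ ∑ k, a k * circleMonomial z k) :
    r * (c 0 + 2 * c 2 + c 4) ≤ ∑ k, a k * c k := by
  have hs : 0 ≤ c 0 + 2 * c 2 + c 4 := by
    have h0 := hc 1 0 1 0
    have h2 := hc 1 0 0 1
    have h4 := hc 0 1 0 1
    simp only [squarePairing] at h0 h2 h4
    linarith
  obtain ⟨z₀, hz₀⟩ := (show Continuous fun z => ∑ k, a k * circleMonomial z k from
    continuous_finsetSum _ fun k _ => continuous_const.mul
      (continuous_circleMonomial k)).exists_forall_le_of_hasCompactMulSupport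
      (HasCompactMulSupport.of_compactSpace _)
  set m := ∑ k, a k * circleMonomial z₀ k with hm
  -- The coefficients of `a - m (u² + v²)²`, nonnegative and zero at the minimizer `z₀`.
  let b : Fin 5 → ℝ := ![a 0 - m, a 1, a 2 - 2 * m, a 3, a 4 - m]
  have hb : ∀ u v, quarticForm b u v = quarticForm a u v - m * (u ^ 2 + v ^ 2) ^ 2 := by
    intro u v
    simp [quarticForm, b]
    ring
  have key := pairing_nonneg_of_zero (a := b) hc (fun u v => ?_) (circle_re_sq_add_im_sq z₀) ?_
  · have : ∑ k, b k * c k = ∑ k, a k * c k - m * (c 0 + 2 * c 2 + c 4) := by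
      simp [Fin.sum_univ_five, b]
      ring
    have := mul_le_mul_of_nonneg_right (hr z₀) hs
    linarith
  · obtain ⟨ρ, z, rfl, rfl⟩ := exists_circle_smul u v
    rw [quarticForm_smul, hb, circle_re_sq_add_im_sq, quarticForm_circle]
    have := hz₀ z
    have : 0 ≤ ρ ^ 4 := by positivity
    exact mul_nonneg this (by linarith)
  · rw [hb, circle_re_sq_add_im_sq, quarticForm_circle, ← hm]
    ring

/-- The set of degree-four moment vectors of probability measures on the unit circle. -/
def circleMoments : Set (Fin 5 → ℝ) :=
  Set.range fun (μ : ProbabilityMeasure (Metric.sphere (0 : ℂ) 1)) k =>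
    ∫ z, circleMonomial z k ∂(μ : Measure (Metric.sphere (0 : ℂ) 1))

lemma isClosed_circleMoments : IsClosed circleMoments := by
  refine (isCompact_range (continuous_pi fun k => ?_)).isClosed
  exact ProbabilityMeasure.continuous_integral_continuousMap
    (⟨_, continuous_circleMonomial k⟩ : C(Metric.sphere (0 : ℂ) 1, ℝ))

lemma integrable_circleMonomial (μ : Measure (Metric.sphere (0 : ℂ) 1)) [IsFiniteMeasure μ]
    (k : Fin 5) : Integrable (fun z => circleMonomial z k) μ :=
  (continuous_circleMonomial k).integrable_of_hasCompactSupport (HasCompactSupport.of_compactSpace _)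

lemma convex_circleMoments : Convex ℝ circleMoments := by
  rintro _ ⟨μ, rfl⟩ _ ⟨ν, rfl⟩ s t hs ht hst
  let ρ : Measure (Metric.sphere (0 : ℂ) 1) :=
    ENNReal.ofReal s • (μ : Measure _) + ENNReal.ofReal t • (ν : Measure _)
  have hρ : IsProbabilityMeasure ρ := ⟨by
    simp [ρ, ← ENNReal.ofReal_add hs ht, hst]⟩
  refine ⟨⟨ρ, hρ⟩, ?_⟩
  ext k
  have h1 := (integrable_circleMonomial (μ : Measure _) k).smul_measure
    (ENNReal.ofReal_ne_top (r := s))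
  have h2 := (integrable_circleMonomial (ν : Measure _) k).smul_measure
    (ENNReal.ofReal_ne_top (r := t))
  change ∫ z, circleMonomial z k ∂ρ = _
  rw [integral_add_measure h1 h2, integral_smul_measure, integral_smul_measure]
  simp [ENNReal.toReal_ofReal hs, ENNReal.toReal_ofReal ht]

lemma circleMonomial_mem_circleMoments (z : Metric.sphere (0 : ℂ) 1) :
    circleMonomial z ∈ circleMoments := by
  refine ⟨⟨Measure.dirac z, inferInstance⟩, ?_⟩
  ext k
  exact integral_dirac _ _

/-- A separating functional would be a quartic that is at least `r` on the circle but pairs with `c`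
to less than `r`, against `pairing_nonneg`. The normalization is total mass one, as `(u² + v²)² = 1`
on the circle. -/
lemma mem_circleMoments {c : Fin 5 → ℝ} (hc : ∀ α β γ δ, 0 ≤ squarePairing c α β γ δ)
    (h1 : c 0 + 2 * c 2 + c 4 = 1) : c ∈ circleMoments := by
  by_contra hcm
  obtain ⟨f, r, hfc, hf⟩ :=
    geometric_hahn_banach_point_closed convex_circleMoments isClosed_circleMoments hcm
  have hsum : ∀ x, f x = ∑ k, f (fun j => if k = j then 1 else 0) * x k := fun x => by
    simpa [mul_comm] using LinearMap.pi_apply_eq_sum_univ (f : (Fin 5 → ℝ) →ₗ[ℝ] ℝ) x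
  have := pairing_nonneg hc (fun k => f (fun j => if k = j then 1 else 0)) r fun z => by
    rw [← hsum]
    exact (hf _ (circleMonomial_mem_circleMoments z)).le
  rw [h1, mul_one, ← hsum] at this
  linarith

/-! ### From moments to `L₄(0, 1)` -/

/-- The quartic form `∑ (4 choose k) c k x ^ (4 - k) y ^ k`. -/
def binomialQuartic (c : Fin 5 → ℝ) (x y : ℝ) : ℝ :=
  c 0 * x ^ 4 + 4 * c 1 * (x ^ 3 * y) + 6 * c 2 * (x ^ 2 * y ^ 2) + 4 * c 3 * (x * y ^ 3)
    + c 4 * y ^ 4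

lemma exists_unitInterval_moments {c : Fin 5 → ℝ}
    (hc : ∀ α β γ δ, 0 ≤ squarePairing c α β γ δ) (h1 : c 0 + 2 * c 2 + c 4 = 1) :
    ∃ Z : ℝ → Metric.sphere (0 : ℂ) 1, Measurable Z ∧ ∀ x y,
      ∫ t in Set.Ioo (0 : ℝ) 1, (x * (Z t : ℂ).re + y * (Z t : ℂ).im) ^ 4
        = binomialQuartic c x y := by
  obtain ⟨μ, rfl⟩ := mem_circleMoments hc h1
  have : Nonempty (Metric.sphere (0 : ℂ) 1) := ⟨⟨1, by simp⟩⟩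
  -- The circle is standard Borel, so `μ` is an image of the uniform measure on the unit interval.
  obtain ⟨f, hf, hfμ⟩ := Measure.exists_measurable_map_eq
    (μ : Measure (Metric.sphere (0 : ℂ) 1))
  refine ⟨fun t => f (Set.projIcc 0 1 zero_le_one t),
    hf.comp continuous_projIcc.measurable, fun x y => ?_⟩
  have hcont : Continuous fun z : Metric.sphere (0 : ℂ) 1 =>
    (x * (z : ℂ).re + y * (z : ℂ).im) ^ 4 := by fun_prop
  rw [← integral_Icc_eq_integral_Ioo, ← integral_subtype_comap measurableSet_Icc]
  have : ∫ t : Set.Icc (0 : ℝ) 1, (x * (f (Set.projIcc 0 1 zero_le_one t) : ℂ).re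
      + y * (f (Set.projIcc 0 1 zero_le_one t) : ℂ).im) ^ 4
      ∂(Measure.comap Subtype.val volume) =
      ∫ z, (x * (z : ℂ).re + y * (z : ℂ).im) ^ 4 ∂(μ : Measure (Metric.sphere (0 : ℂ) 1)) := by
    rw [← hfμ, integral_map hf.aemeasurable hcont.aestronglyMeasurable]
    simp only [Set.projIcc_val]
    rfl
  rw [this]
  have hi := integrable_circleMonomial (μ : Measure (Metric.sphere (0 : ℂ) 1))
  have hexp : ∀ z : Metric.sphere (0 : ℂ) 1, (x * (z : ℂ).re + y * (z : ℂ).im) ^ 4 =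
      ∑ k : Fin 5, (![x ^ 4, 4 * (x ^ 3 * y), 6 * (x ^ 2 * y ^ 2), 4 * (x * y ^ 3), y ^ 4] k)
        * circleMonomial z k := by
    intro z
    simp [Fin.sum_univ_five, circleMonomial]
    ring
  simp_rw [hexp]
  rw [integral_finsetSum _ fun k _ => (hi k).const_mul _]
  simp_rw [integral_const_mul]
  simp [Fin.sum_univ_five, binomialQuartic]
  ring

lemma eq_zero_of_forall_quadratic_nonneg {b d : ℝ} (h : ∀ t, 0 ≤ 2 * t * b + t ^ 2 * d)
    (hd : d = 0) : b = 0 := by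
  have h1 := h 1
  have h2 := h (-1)
  rw [hd] at h1 h2
  linarith

/-- A binary quartic form whose polar functional is nonnegative on products of squares of linear
forms is the fourth power of the norm of a two-dimensional subspace of `L₄(0, 1)`. -/
theorem exists_Lp_binomialQuartic {c : Fin 5 → ℝ}
    (hc : ∀ α β γ δ, 0 ≤ squarePairing c α β γ δ) :
    ∃ φ : (ℝ × ℝ) →ₗ[ℝ] Lp ℝ 4 (volume.restrict (Set.Ioo (0 : ℝ) 1)),
      ∀ v, ‖φ v‖ = (binomialQuartic c v.1 v.2) ^ (1 / 4 : ℝ) := by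
  have h0 := hc 1 0 1 0
  have h2 := hc 1 0 0 1
  have h4 := hc 0 1 0 1
  have h1 := fun t => hc 1 0 1 t
  have h3 := fun t => hc 0 1 t 1
  simp only [squarePairing] at h0 h2 h4 h1 h3
  norm_num at h0 h2 h4
  rcases (show 0 ≤ c 0 + 2 * c 2 + c 4 by positivity).eq_or_lt with hs | hs
  -- With total mass zero every coefficient vanishes, and the zero map works.
  · have e0 : c 0 = 0 := by linarith
    have e2 : c 2 = 0 := by linarith
    have e4 : c 4 = 0 := by linarith
    have e1 : c 1 = 0 := eq_zero_of_forall_quadratic_nonneg (fun t => by linarith [h1 t]) e2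
    have e3 : c 3 = 0 := eq_zero_of_forall_quadratic_nonneg (fun t => by linarith [h3 t]) e2
    refine ⟨0, fun v => ?_⟩
    simp [binomialQuartic, e0, e1, e2, e3, e4]
  · set s := c 0 + 2 * c 2 + c 4 with hsdef
    obtain ⟨Z, hZ, hint⟩ := exists_unitInterval_moments (c := fun k => s⁻¹ * c k)
      (fun α β γ δ => by
        have : squarePairing (fun k => s⁻¹ * c k) α β γ δ = s⁻¹ * squarePairing c α β γ δ := by
          simp only [squarePairing]
          ring
        rw [this]
        exact mul_nonneg (inv_nonneg.2 hs.le) (hc α β γ δ))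
      (by
        have : s⁻¹ * s = 1 := inv_mul_cancel₀ hs.ne'
        rw [hsdef] at this ⊢
        linarith)
    let ν := volume.restrict (Set.Ioo (0 : ℝ) 1)
    have hre : MemLp (fun t => (Z t : ℂ).re) 4 ν := by
      refine MemLp.of_bound (Complex.measurable_re.comp
        (measurable_subtype_coe.comp hZ)).aestronglyMeasurable 1 (.of_forall fun t => ?_)
      have : ‖(Z t : ℂ)‖ = 1 := mem_sphere_zero_iff_norm.1 (Z t).2
      exact (Complex.abs_re_le_norm _).trans this.le
    have him : MemLp (fun t => (Z t : ℂ).im) 4 ν := by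
      refine MemLp.of_bound (Complex.measurable_im.comp
        (measurable_subtype_coe.comp hZ)).aestronglyMeasurable 1 (.of_forall fun t => ?_)
      have : ‖(Z t : ℂ)‖ = 1 := mem_sphere_zero_iff_norm.1 (Z t).2
      exact (Complex.abs_im_le_norm _).trans this.le
    let r : ℝ := s ^ (1 / 4 : ℝ)
    have hr : r ^ 4 = s := by
      simp only [r]
      rw [← Real.rpow_natCast, ← Real.rpow_mul hs.le]
      norm_num
    refine ⟨(LinearMap.fst ℝ ℝ ℝ).smulRight (r • hre.toLp _)
      + (LinearMap.snd ℝ ℝ ℝ).smulRight (r • him.toLp _), fun v => ?_⟩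
    have hm : MemLp (fun t => r * (v.1 * (Z t : ℂ).re + v.2 * (Z t : ℂ).im)) 4 ν :=
      ((hre.const_mul v.1).add (him.const_mul v.2)).const_mul r
    have heq : ((LinearMap.fst ℝ ℝ ℝ).smulRight (r • hre.toLp _)
      + (LinearMap.snd ℝ ℝ ℝ).smulRight (r • him.toLp _)) v = hm.toLp _ := by
      simp only [LinearMap.add_apply, LinearMap.smulRight_apply, LinearMap.fst_apply,
        LinearMap.snd_apply, ← MemLp.toLp_const_smul, ← MemLp.toLp_add]
      refine MemLp.toLp_congr _ _ (.of_forall fun t => ?_)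
      simp
      ring
    rw [heq, Lp.norm_toLp, hm.eLpNorm_eq_integral_rpow_norm (by norm_num) (by norm_num)]
    have hi : ∫ t, ‖r * (v.1 * (Z t : ℂ).re + v.2 * (Z t : ℂ).im)‖ ^ (4 : ENNReal).toReal ∂ν
        = binomialQuartic c v.1 v.2 := by
      have : ∀ a : ℝ, ‖a‖ ^ (4 : ENNReal).toReal = a ^ 4 := fun a => by
        rw [ENNReal.toReal_ofNat, show (4 : ℝ) = ((4 : ℕ) : ℝ) by norm_num, Real.rpow_natCast,
          Real.norm_eq_abs, (show Even 4 by decide).pow_abs]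
      simp_rw [this, mul_pow r, hr]
      rw [integral_const_mul, hint, binomialQuartic, binomialQuartic]
      field_simp
    rw [hi, ENNReal.toReal_ofReal (Real.rpow_nonneg ?_ _)]
    · norm_num
    · rw [← hi]
      exact integral_nonneg fun t => by positivity

/-! ### Hilbert-Schmidt sums -/

section HilbertSchmidt

variable {H : Type*} [NormedAddCommGroup H] [InnerProductSpace ℂ H]

open scoped InnerProductSpace

lemma isCompactOperator_smul_add {A B : H →L[ℂ] H} (hA : IsCompactOperator A)
    (hB : IsCompactOperator B) (x y : ℝ) : IsCompactOperator (x • A + y • B) :=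
  (hA.smul x).add (hB.smul y)

/-- The sum `∑ ‖T b_i‖²` over a Hilbert basis. -/
noncomputable def hsSum {ι : Type*} (b : HilbertBasis ι ℂ H) (T : H →L[ℂ] H) : ENNReal :=
  ∑' i, ENNReal.ofReal (‖T (b i)‖ ^ 2)

lemma hasSum_norm_inner_sq {ι : Type*} (b : HilbertBasis ι ℂ H) (x : H) :
    HasSum (fun i => ‖⟪b i, x⟫_ℂ‖ ^ 2) (‖x‖ ^ 2) := by
  have h := Complex.hasSum_re (b.hasSum_inner_mul_inner x x)
  rw [inner_self_eq_norm_sq_to_K] at h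
  convert h using 1
  · ext i
    rw [← inner_conj_symm x, ← Complex.normSq_eq_conj_mul_self, Complex.normSq_eq_norm_sq,
      Complex.ofReal_re]
  · norm_cast

/-- Both sides equal the double sum of `‖⟪d j, T (b i)⟫‖²`; values in `ENNReal` allow the exchange
without summability. -/
lemma hsSum_congr_basis {ι κ : Type*} (b : HilbertBasis ι ℂ H) (d : HilbertBasis κ ℂ H)
    {T : H →L[ℂ] H} (hT : T.IsSymmetric) : hsSum b T = hsSum d T := by
  have key : ∀ x : H, ENNReal.ofReal (‖x‖ ^ 2) = ∑' j, ENNReal.ofReal (‖⟪d j, x⟫_ℂ‖ ^ 2) := by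
    intro x
    rw [← (hasSum_norm_inner_sq d x).tsum_eq,
      ENNReal.ofReal_tsum_of_nonneg (fun _ => by positivity) (hasSum_norm_inner_sq d x).summable]
  have key' : ∀ x : H, ENNReal.ofReal (‖x‖ ^ 2) = ∑' j, ENNReal.ofReal (‖⟪b j, x⟫_ℂ‖ ^ 2) := by
    intro x
    rw [← (hasSum_norm_inner_sq b x).tsum_eq,
      ENNReal.ofReal_tsum_of_nonneg (fun _ => by positivity) (hasSum_norm_inner_sq b x).summable]
  unfold hsSum
  simp_rw [key (T (b _)), key' (T (d _))]
  rw [ENNReal.tsum_comm]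
  refine tsum_congr fun j => tsum_congr fun i => ?_
  have : ⟪T (d j), b i⟫_ℂ = ⟪d j, T (b i)⟫_ℂ := hT (d j) (b i)
  rw [← this, norm_inner_symm]

lemma hsSum_ne_top_iff_memlp {ι : Type*} (b : HilbertBasis ι ℂ H) (T : H →L[ℂ] H) :
    hsSum b T ≠ ⊤ ↔ Memℓp (fun i => T (b i)) 2 := by
  rw [memℓp_gen_iff (by norm_num)]
  simp only [ENNReal.toReal_ofNat, Real.rpow_ofNat]
  refine ⟨fun h => ?_, fun h => h.tsum_ofReal_ne_top⟩
  have := ENNReal.summable_toReal h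
  simpa only [ENNReal.toReal_ofReal (sq_nonneg _)] using this

lemma toReal_hsSum {ι : Type*} (b : HilbertBasis ι ℂ H) (T : H →L[ℂ] H)
    (f : lp (fun _ : ι => H) 2) (hf : ∀ i, f i = T (b i)) :
    (hsSum b T).toReal = ‖f‖ ^ 2 := by
  have h := lp.norm_rpow_eq_tsum (p := 2) (by norm_num) f
  simp only [ENNReal.toReal_ofNat, Real.rpow_ofNat] at h
  rw [h, hsSum, ENNReal.tsum_toReal_eq fun _ => ENNReal.ofReal_ne_top]
  simp only [ENNReal.toReal_ofReal (sq_nonneg _), hf]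

end HilbertSchmidt

/-! ### Gram operators and singular values -/

/-- The Gram operator `X* X`. -/
noncomputable def gram {H : Type*} [NormedAddCommGroup H] [InnerProductSpace ℂ H] [CompleteSpace H]
    (X : H →L[ℂ] H) : H →L[ℂ] H :=
  (ContinuousLinearMap.adjoint X).comp X

section Operators

variable {H : Type*} [NormedAddCommGroup H] [InnerProductSpace ℂ H] [CompleteSpace H]

open scoped InnerProductSpace

lemma gram_isSymmetric (X : H →L[ℂ] H) : (gram X).IsSymmetric := fun x y => by
  simp [gram, ContinuousLinearMap.adjoint_inner_left, ContinuousLinearMap.adjoint_inner_right]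

lemma inner_gram_self (X : H →L[ℂ] H) (x : H) : ⟪x, gram X x⟫_ℂ = (‖X x‖ : ℂ) ^ 2 := by
  rw [gram, ContinuousLinearMap.comp_apply, ContinuousLinearMap.adjoint_inner_right,
    inner_self_eq_norm_sq_to_K]
  rfl

lemma isCompactOperator_gram {X : H →L[ℂ] H} (hX : IsCompactOperator X) :
    IsCompactOperator (gram X) :=
  hX.clm_comp (ContinuousLinearMap.adjoint X)

lemma mem_singularSpace {X : H →L[ℂ] H} {s : ℝ} {x : H} :
    x ∈ singularSpace X s ↔ gram X x = ((s : ℂ) ^ 2) • x :=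
  Module.End.mem_eigenspace_iff

lemma finiteDimensional_singularSpace {X : H →L[ℂ] H} (hX : IsCompactOperator X) {s : ℝ}
    (hs : 0 < s) : FiniteDimensional ℂ (singularSpace X s) :=
  ContinuousLinearMap.finite_dimensional_eigenspace (isCompactOperator_gram hX) _
    (pow_ne_zero 2 (Complex.ofReal_ne_zero.2 hs.ne'))

lemma orthogonalFamily_singularSpace (X : H →L[ℂ] H) :
    OrthogonalFamily ℂ (fun s : {s : ℝ // 0 < s} => singularSpace X s.1)
      (fun s => (singularSpace X s.1).subtypeₗᵢ) := by
  refine (gram_isSymmetric X).orthogonalFamily_eigenspaces.comp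
    (γ := {s : ℝ // 0 < s}) (f := fun s => ((s.1 : ℂ) ^ 2)) ?_
  rintro ⟨s, hs⟩ ⟨t, ht⟩ h
  have : s ^ 2 = t ^ 2 := by
    have h' : (s : ℂ) ^ 2 = (t : ℂ) ^ 2 := h
    exact_mod_cast h'
  exact Subtype.ext ((pow_left_inj₀ hs.le ht.le two_ne_zero).1 this)

/-- A vector orthogonal to all singular spaces of a compact operator lies in its kernel. -/
lemma gram_apply_eq_zero {X : H →L[ℂ] H} (hX : IsCompactOperator X) {u : H}
    (hu : ∀ s : ℝ, 0 < s → ∀ x ∈ singularSpace X s, ⟪x, u⟫_ℂ = 0) : gram X u = 0 := by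
  have hbot := ContinuousLinearMap.orthogonalComplement_iSup_eigenspaces_eq_bot
    (isCompactOperator_gram hX) (gram_isSymmetric X)
  rw [← Submodule.mem_bot ℂ, ← hbot, ← Submodule.iInf_orthogonal, Submodule.mem_iInf]
  intro μ
  rw [Submodule.mem_orthogonal]
  intro x hx
  have hx' : gram X x = μ • x := Module.End.mem_eigenspace_iff.1 hx
  have hsymm : ⟪x, gram X u⟫_ℂ = ⟪gram X x, u⟫_ℂ := ((gram_isSymmetric X) x u).symm
  rw [hsymm, hx', inner_smul_left]
  by_cases hx0 : x = 0
  · simp [hx0]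
  -- Every eigenvalue is the square of `‖X x‖ / ‖x‖`: it is zero, or its eigenspace is a singular
  -- space.
  have hμ : μ * ((‖x‖ ^ 2 : ℝ) : ℂ) = ((‖X x‖ ^ 2 : ℝ) : ℂ) := by
    have := inner_gram_self X x
    rw [hx', inner_smul_right, inner_self_eq_norm_sq_to_K] at this
    simpa using this
  have hxn : 0 < ‖x‖ := norm_pos_iff.2 hx0
  have hμ' : μ = (((‖X x‖ / ‖x‖ : ℝ)) : ℂ) ^ 2 := by
    have hne : ((‖x‖ ^ 2 : ℝ) : ℂ) ≠ 0 := Complex.ofReal_ne_zero.2 (by positivity)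
    rw [eq_div_of_mul_eq hne hμ]
    push_cast
    ring
  rcases (norm_nonneg (X x)).eq_or_lt with h0 | h0
  · simp [hμ', ← h0]
  · rw [hu (‖X x‖ / ‖x‖) (by positivity) x (mem_singularSpace.2 (hμ' ▸ hx')), mul_zero]

/-- A compact operator `X` admits a Hilbert basis of eigenvectors of `X* X` in which the nonzero
eigenvalues are listed by the singular values of `X`. -/
theorem exists_singular_hilbertBasis {X : H →L[ℂ] H} (hX : IsCompactOperator X) :
    ∃ (w : Set H) (b : HilbertBasis w ℂ H) (e : SingularIndex X → w), Function.Injective e ∧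
      (∀ i, gram X (b (e i)) = ((singularValue X i : ℂ) ^ 2) • b (e i)) ∧
      ∀ j ∉ Set.range e, gram X (b j) = 0 := by
  have hfin := fun s : {s : ℝ // 0 < s} => finiteDimensional_singularSpace hX s.2
  let v (i : SingularIndex X) : H := stdOrthonormalBasis ℂ (singularSpace X i.1.1) i.2
  have hv : Orthonormal ℂ v :=
    (orthogonalFamily_singularSpace X).orthonormal_sigma_orthonormal
      (fun s => (stdOrthonormalBasis ℂ (singularSpace X s.1)).orthonormal)
  obtain ⟨w, b, hw, hb⟩ := hv.toSubtypeRange.exists_hilbertBasis_extension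
  have hbv : ∀ x : w, b x = x := fun x => congrFun hb x
  refine ⟨w, b, fun i => ⟨v i, hw ⟨i, rfl⟩⟩, fun i j h => ?_, fun i => ?_, fun j hj => ?_⟩
  · exact hv.linearIndependent.injective (congrArg Subtype.val h)
  · rw [hbv]
    exact mem_singularSpace.1 (stdOrthonormalBasis ℂ (singularSpace X i.1.1) i.2).2
  · refine gram_apply_eq_zero hX fun s hs x hx => ?_
    have := hfin ⟨s, hs⟩
    have h : _ = x := congrArg Subtype.val
      ((stdOrthonormalBasis ℂ (singularSpace X s)).sum_repr ⟨x, hx⟩)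
    rw [← h, Submodule.coe_sum, sum_inner]
    refine Finset.sum_eq_zero fun k _ => ?_
    have hne : (⟨v ⟨⟨s, hs⟩, k⟩, hw ⟨_, rfl⟩⟩ : w) ≠ j := fun h => hj ⟨_, h⟩
    have h0 : ⟪b _, b j⟫_ℂ = 0 := b.orthonormal.2 hne
    rw [hbv ⟨v ⟨⟨s, hs⟩, k⟩, hw ⟨_, rfl⟩⟩] at h0
    rw [Submodule.coe_smul, inner_smul_left]
    exact mul_eq_zero_of_right _ h0

/-- In an eigenbasis of `X* X`, the terms of the Hilbert-Schmidt sum are `σ⁴` or zero. -/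
lemma tsum_singularValue_eq_hsSum {ι : Type*} (b : HilbertBasis ι ℂ H) {X : H →L[ℂ] H}
    (hX : IsCompactOperator X) :
    ∑' i, ENNReal.ofReal (singularValue X i ^ (4 : ℝ)) = hsSum b (gram X) := by
  obtain ⟨w, d, e, he, h1, h2⟩ := exists_singular_hilbertBasis hX
  rw [hsSum_congr_basis b d (gram_isSymmetric X), hsSum]
  rw [← he.tsum_eq (f := fun j => ENNReal.ofReal (‖gram X (d j)‖ ^ 2))]
  · refine tsum_congr fun i => ?_
    rw [h1, norm_smul, d.orthonormal.1, mul_one, norm_pow, Complex.norm_real, ← pow_mul,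
      Real.norm_eq_abs, (show Even (2 * 2) by decide).pow_abs]
    exact congrArg _ (Real.rpow_natCast _ 4)
  · intro j hj
    by_contra hne
    exact hj (by simp [h2 j hne])

lemma singularValue_rpow_nonneg (X : H →L[ℂ] H) (i : SingularIndex X) :
    0 ≤ singularValue X i ^ (4 : ℝ) :=
  Real.rpow_nonneg i.1.2.le _

lemma memSchatten_four_iff {ι : Type*} (b : HilbertBasis ι ℂ H) {X : H →L[ℂ] H}
    (hX : IsCompactOperator X) : MemSchatten 4 X ↔ hsSum b (gram X) ≠ ⊤ := by
  rw [← tsum_singularValue_eq_hsSum b hX]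
  refine ⟨fun h => h.2.tsum_ofReal_ne_top, fun h => ⟨hX, ?_⟩⟩
  have := ENNReal.summable_toReal h
  simpa only [ENNReal.toReal_ofReal (singularValue_rpow_nonneg X _)] using this

lemma schattenNorm_four {ι : Type*} (b : HilbertBasis ι ℂ H) {X : H →L[ℂ] H}
    (hX : IsCompactOperator X) :
    schattenNorm 4 X = (hsSum b (gram X)).toReal ^ (1 / 4 : ℝ) := by
  rw [← tsum_singularValue_eq_hsSum b hX, ENNReal.tsum_toReal_eq fun _ => ENNReal.ofReal_ne_top]
  simp only [ENNReal.toReal_ofReal (singularValue_rpow_nonneg X _)]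
  rfl

lemma exists_gram_eigenbasis {X : H →L[ℂ] H} (hX : IsCompactOperator X) :
    ∃ (w : Set H) (b : HilbertBasis w ℂ H) (l : w → ℝ), (∀ j, 0 ≤ l j) ∧
      ∀ j, gram X (b j) = (l j : ℂ) • b j := by
  obtain ⟨w, d, e, -, h1, h2⟩ := exists_singular_hilbertBasis hX
  have : ∀ j, ∃ l : ℝ, 0 ≤ l ∧ gram X (d j) = (l : ℂ) • d j := by
    intro j
    by_cases hj : j ∈ Set.range e
    · obtain ⟨i, rfl⟩ := hj
      exact ⟨singularValue X i ^ 2, sq_nonneg _, by rw [h1]; push_cast; rfl⟩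
    · exact ⟨0, le_rfl, by simp [h2 j hj]⟩
  choose l hl0 hl using this
  exact ⟨w, d, l, hl0, hl⟩

/-- Monotonicity of the Hilbert-Schmidt sum on positive operators. -/
lemma hsSum_gram_le {ι : Type*} (b : HilbertBasis ι ℂ H) {X D : H →L[ℂ] H}
    (hX : IsCompactOperator X) (hD : D.IsSymmetric)
    (hle : ∀ x, ‖X x‖ ^ 2 ≤ (⟪x, D x⟫_ℂ).re) : hsSum b (gram X) ≤ hsSum b D := by
  -- On a unit eigenvector `d`, `‖gram X d‖ = ‖X d‖² ≤ re ⟪d, D d⟫ ≤ ‖D d‖`, so the sums compare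
  -- termwise.
  obtain ⟨w, d, l, hl0, hl⟩ := exists_gram_eigenbasis hX
  rw [hsSum_congr_basis b d (gram_isSymmetric X), hsSum_congr_basis b d hD]
  refine ENNReal.tsum_le_tsum fun j => ENNReal.ofReal_le_ofReal ?_
  have hn : ‖d j‖ = 1 := d.orthonormal.1 j
  have h1 : ‖gram X (d j)‖ = ‖X (d j)‖ ^ 2 := by
    have := inner_gram_self X (d j)
    rw [hl, inner_smul_right, inner_self_eq_norm_sq_to_K, hn] at this
    have h : l j = ‖X (d j)‖ ^ 2 := by
      apply Complex.ofReal_injective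
      simpa using this
    rw [hl, norm_smul, hn, mul_one, Complex.norm_real, Real.norm_of_nonneg (hl0 j), h]
  refine pow_le_pow_left₀ (norm_nonneg _) ?_ 2
  rw [h1]
  refine (hle _).trans ((Complex.re_le_norm _).trans ((norm_inner_le_norm _ _).trans ?_))
  rw [hn, one_mul]

/-- The Hilbert-Schmidt product of two positive operators is nonnegative. -/
lemma hsSum_gram_sub_le {ι : Type*} (b : HilbertBasis ι ℂ H) {X : H →L[ℂ] H}
    (hX : IsCompactOperator X) (Y : H →L[ℂ] H) :
    hsSum b (gram X - gram Y) ≤ hsSum b (gram X + gram Y) := by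
  obtain ⟨w, d, l, hl0, hl⟩ := exists_gram_eigenbasis hX
  have hs := LinearMap.IsSymmetric.sub (gram_isSymmetric X) (gram_isSymmetric Y)
  have ha := LinearMap.IsSymmetric.add (gram_isSymmetric X) (gram_isSymmetric Y)
  rw [hsSum_congr_basis b d hs, hsSum_congr_basis b d ha]
  refine ENNReal.tsum_le_tsum fun j => ENNReal.ofReal_le_ofReal ?_
  simp only [sub_apply, add_apply]
  -- The two terms differ only in the sign of twice the cross term `l j * ‖Y (d j)‖²`, which is
  -- nonnegative.
  rw [@norm_sub_sq ℂ, @norm_add_sq ℂ, hl, inner_smul_left, inner_gram_self]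
  have : 0 ≤ RCLike.re ((starRingEnd ℂ) (l j : ℂ) * (‖Y (d j)‖ : ℂ) ^ 2) := by
    rw [Complex.conj_ofReal]
    have h := mul_nonneg (hl0 j) (sq_nonneg ‖Y (d j)‖)
    have e : (l j : ℂ) * (‖Y (d j)‖ : ℂ) ^ 2 = ((l j * ‖Y (d j)‖ ^ 2 : ℝ) : ℂ) := by push_cast; rfl
    rw [e]
    exact h
  linarith

end Operators

/-! ### Squared norms of vector-valued quadratic forms -/

section Hankel

open scoped InnerProductSpace

variable {E : Type*} [NormedAddCommGroup E] [InnerProductSpace ℝ E]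

/-- The coefficients of the binary quartic form `‖x² p + x y q + y² r‖²`, without the binomial
factors. -/
noncomputable def normQuarticCoeff (p q r : E) : Fin 5 → ℝ :=
  ![⟪p, p⟫_ℝ, ⟪p, q⟫_ℝ / 2, (⟪q, q⟫_ℝ + 2 * ⟪p, r⟫_ℝ) / 6, ⟪q, r⟫_ℝ / 2, ⟪r, r⟫_ℝ]

lemma binomialQuartic_normQuarticCoeff (p q r : E) (x y : ℝ) :
    binomialQuartic (normQuarticCoeff p q r) x y
      = ‖x ^ 2 • p + (x * y) • q + y ^ 2 • r‖ ^ 2 := by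
  rw [← real_inner_self_eq_norm_sq]
  simp only [inner_add_left, inner_add_right, real_inner_smul_left, real_inner_smul_right,
    real_inner_comm p q, real_inner_comm p r, real_inner_comm q r]
  simp [binomialQuartic, normQuarticCoeff]
  ring

lemma squarePairing_normQuarticCoeff (p q r : E) (α β γ δ : ℝ) :
    squarePairing (normQuarticCoeff p q r) α β γ δ =
      (‖(2 * α * γ) • p + (α * δ + β * γ) • q + (2 * β * δ) • r‖ ^ 2
        + 2 * ⟪α ^ 2 • p + (α * β) • q + β ^ 2 • r,
          γ ^ 2 • p + (γ * δ) • q + δ ^ 2 • r⟫_ℝ) / 6 := by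
  rw [← real_inner_self_eq_norm_sq]
  simp only [inner_add_left, inner_add_right, real_inner_smul_left, real_inner_smul_right]
  simp only [squarePairing, normQuarticCoeff]
  simp [real_inner_comm p q, real_inner_comm p r, real_inner_comm q r]
  ring

/-- A vector-valued quadratic form with pairwise nonnegative inner products has its squared norm
represented by fourth powers of norms in `L₄(0, 1)`. -/
theorem exists_Lp_norm_sq_quadratic {G : ℝ → ℝ → E} {p q r : E}
    (hG : ∀ x y, G x y = x ^ 2 • p + (x * y) • q + y ^ 2 • r)
    (hpos : ∀ α β γ δ, 0 ≤ ⟪G α β, G γ δ⟫_ℝ) :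
    ∃ φ : (ℝ × ℝ) →ₗ[ℝ] Lp ℝ 4 (volume.restrict (Set.Ioo (0 : ℝ) 1)),
      ∀ v, ‖φ v‖ = (‖G v.1 v.2‖ ^ 2) ^ (1 / 4 : ℝ) := by
  obtain ⟨φ, hφ⟩ := exists_Lp_binomialQuartic (c := normQuarticCoeff p q r) fun α β γ δ => by
    rw [squarePairing_normQuarticCoeff, ← hG, ← hG]
    have := hpos α β γ δ
    positivity
  exact ⟨φ, fun v => by rw [hφ, binomialQuartic_normQuarticCoeff, hG]⟩

end Hankel

/-! ### Real combinations of two operators -/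

section Operators

variable {H : Type*} [NormedAddCommGroup H] [InnerProductSpace ℂ H] [CompleteSpace H]

open scoped InnerProductSpace

lemma gram_smul_add_smul (A B : H →L[ℂ] H) (x y : ℝ) :
    gram (x • A + y • B) = x ^ 2 • gram A + (x * y) • (gram (A + B) - gram A - gram B)
      + y ^ 2 • gram B := by
  have key : ∀ x y : ℝ, ∀ u v, ⟪u, gram (x • A + y • B) v⟫_ℂ =
      x ^ 2 * ⟪A u, A v⟫_ℂ + x * y * (⟪A u, B v⟫_ℂ + ⟪B u, A v⟫_ℂ) + y ^ 2 * ⟪B u, B v⟫_ℂ := by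
    intro x y u v
    simp only [gram, ContinuousLinearMap.comp_apply, ContinuousLinearMap.adjoint_inner_right,
      add_apply, smul_apply, inner_add_left, inner_add_right, ← Complex.coe_smul,
      inner_smul_left, inner_smul_right, Complex.conj_ofReal]
    ring
  have kA := key 1 0
  have kB := key 0 1
  have kAB := key 1 1
  simp only [one_smul, zero_smul, add_zero, zero_add] at kA kB kAB
  ext v
  refine ext_inner_left ℂ fun u => ?_
  rw [key]
  simp only [add_apply, smul_apply, sub_apply, inner_add_right, inner_sub_right,
    ← Complex.coe_smul, inner_smul_right, kA, kB, kAB]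
  push_cast
  ring

/-- This operator bound `(xA + yB)*(xA + yB) ≤ 2x² A*A + 2y² B*B` keeps real combinations in `S₄`,
through `hsSum_gram_le`. -/
lemma norm_smul_add_smul_sq_le (A B : H →L[ℂ] H) (x y : ℝ) (v : H) :
    ‖(x • A + y • B) v‖ ^ 2
      ≤ (⟪v, ((2 * x ^ 2) • gram A + (2 * y ^ 2) • gram B) v⟫_ℂ).re := by
  have e : ⟪v, ((2 * x ^ 2) • gram A + (2 * y ^ 2) • gram B) v⟫_ℂ
      = ((2 * x ^ 2 * ‖A v‖ ^ 2 + 2 * y ^ 2 * ‖B v‖ ^ 2 : ℝ) : ℂ) := by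
    simp only [add_apply, smul_apply, inner_add_right, ← Complex.coe_smul, inner_smul_right,
      inner_gram_self]
    push_cast
    ring
  rw [e, Complex.ofReal_re]
  have h1 : ‖(x • A + y • B) v‖ ≤ |x| * ‖A v‖ + |y| * ‖B v‖ := by
    refine (norm_add_le _ _).trans (le_of_eq ?_)
    simp [norm_smul]
  have h2 := pow_le_pow_left₀ (norm_nonneg _) h1 2
  nlinarith [sq_nonneg (|x| * ‖A v‖ - |y| * ‖B v‖), sq_abs x, sq_abs y]

lemma isSymmetric_smul_gram_add (A B : H →L[ℂ] H) (x y : ℝ) :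
    (x • gram A + y • gram B).IsSymmetric := by
  intro u v
  have hA : ⟪gram A u, v⟫_ℂ = ⟪u, gram A v⟫_ℂ := gram_isSymmetric A u v
  have hB : ⟪gram B u, v⟫_ℂ = ⟪u, gram B v⟫_ℂ := gram_isSymmetric B u v
  simp only [ContinuousLinearMap.coe_coe, add_apply, smul_apply, inner_add_left, inner_add_right,
    ← Complex.coe_smul, inner_smul_left, inner_smul_right, Complex.conj_ofReal, hA, hB]

/-- The Gram operators of real combinations of `A` and `B` are Hilbert-Schmidt. -/
lemma memlp_gram_smul_add {ι : Type*} (b : HilbertBasis ι ℂ H) {A B : H →L[ℂ] H}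
    (hA : MemSchatten 4 A) (hB : MemSchatten 4 B) (x y : ℝ) :
    Memℓp (fun i => gram (x • A + y • B) (b i)) 2 := by
  have hPA := (hsSum_ne_top_iff_memlp b _).1 ((memSchatten_four_iff b hA.1).1 hA)
  have hPB := (hsSum_ne_top_iff_memlp b _).1 ((memSchatten_four_iff b hB.1).1 hB)
  have hD : hsSum b ((2 * x ^ 2) • gram A + (2 * y ^ 2) • gram B) ≠ ⊤ :=
    (hsSum_ne_top_iff_memlp b _).2
      ((hPA.const_smul (2 * x ^ 2)).add (hPB.const_smul (2 * y ^ 2)))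
  exact (hsSum_ne_top_iff_memlp b _).1 (ne_top_of_le_ne_top hD
    (hsSum_gram_le b (isCompactOperator_smul_add hA.1 hB.1 x y)
      (isSymmetric_smul_gram_add A B _ _) (norm_smul_add_smul_sq_le A B x y)))

/-- Polarization: `4 re ⟪f, g⟫ = ‖f + g‖² - ‖f - g‖²`, and `hsSum_gram_sub_le` compares the two
norms. -/
lemma inner_gram_nonneg {ι : Type*} (b : HilbertBasis ι ℂ H) {X Y : H →L[ℂ] H}
    (hX : IsCompactOperator X) (f g : lp (fun _ : ι => H) 2) (hf : ∀ i, f i = gram X (b i))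
    (hg : ∀ i, g i = gram Y (b i)) : 0 ≤ (⟪f, g⟫_ℂ).re := by
  have ha := toReal_hsSum b (gram X + gram Y) (f + g) fun i => by
    simp [hf, hg]
  have hs := toReal_hsSum b (gram X - gram Y) (f - g) fun i => by
    simp [hf, hg]
  have hne : hsSum b (gram X + gram Y) ≠ ⊤ := by
    rw [hsSum_ne_top_iff_memlp]
    have h : (fun i => (gram X + gram Y) (b i)) = ⇑(f + g) := by
      ext i
      simp [hf, hg]
    exact h ▸ lp.memℓp (f + g)
  have := ENNReal.toReal_mono hne (hsSum_gram_sub_le b hX Y)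
  rw [ha, hs, @norm_add_sq ℂ, @norm_sub_sq ℂ] at this
  simp only [RCLike.re_to_complex] at this
  linarith

/-- The quartic form `‖x A + y B‖_{S₄}⁴` is represented in `L₄(0, 1)`. -/
theorem exists_linearMap_schattenNorm {A B : H →L[ℂ] H} (hA : MemSchatten 4 A)
    (hB : MemSchatten 4 B) :
    ∃ φ : (ℝ × ℝ) →ₗ[ℝ] Lp ℝ 4 (volume.restrict (Set.Ioo (0 : ℝ) 1)),
      ∀ v, MemSchatten 4 (v.1 • A + v.2 • B) ∧ ‖φ v‖ = schattenNorm 4 (v.1 • A + v.2 • B) := by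
  obtain ⟨w, b, -⟩ := exists_hilbertBasis ℂ H
  have hm := memlp_gram_smul_add b hA hB
  let G (x y : ℝ) : lp (fun _ : w => H) 2 := ⟨fun i => gram (x • A + y • B) (b i), hm x y⟩
  let p := G 1 0
  let r := G 0 1
  let q := G 1 1 - p - r
  have hG : ∀ x y, G x y = x ^ 2 • p + (x * y) • q + y ^ 2 • r := by
    intro x y
    ext i
    have h := congrArg (fun T : H →L[ℂ] H => T (b i)) (gram_smul_add_smul A B x y)
    simp only [sub_apply, add_apply, smul_apply] at h
    change gram (x • A + y • B) (b i) = x ^ 2 • gram ((1 : ℝ) • A + (0 : ℝ) • B) (b i)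
      + (x * y) • (gram ((1 : ℝ) • A + (1 : ℝ) • B) (b i)
        - gram ((1 : ℝ) • A + (0 : ℝ) • B) (b i) - gram ((0 : ℝ) • A + (1 : ℝ) • B) (b i))
      + y ^ 2 • gram ((0 : ℝ) • A + (1 : ℝ) • B) (b i)
    simpa only [one_smul, zero_smul, add_zero, zero_add] using h
  let _ : InnerProductSpace ℝ (lp (fun _ : w => H) 2) := InnerProductSpace.complexToReal
  obtain ⟨φ, hφ⟩ := exists_Lp_norm_sq_quadratic hG fun α β γ δ =>
    inner_gram_nonneg b (isCompactOperator_smul_add hA.1 hB.1 α β) (G α β) (G γ δ)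
      (fun _ => rfl) (fun _ => rfl)
  refine ⟨φ, fun v => ?_⟩
  have hcomp := isCompactOperator_smul_add hA.1 hB.1 v.1 v.2
  refine ⟨(memSchatten_four_iff b hcomp).2 ((hsSum_ne_top_iff_memlp b _).2 (hm v.1 v.2)), ?_⟩
  rw [hφ, schattenNorm_four b hcomp,
    toReal_hsSum b _ (G v.1 v.2) fun _ => rfl]

end Operators

theorem mainTheorem7 {H : Type*} [NormedAddCommGroup H] [InnerProductSpace ℂ H] [CompleteSpace H]
    [TopologicalSpace.SeparableSpace H] (A B : H →L[ℂ] H)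
    (hA : MemSchatten 4 A) (hB : MemSchatten 4 B) :
    ∃ T : Submodule.span ℝ ({A, B} : Set (H →L[ℂ] H)) →ₗ[ℝ]
        Lp ℝ 4 (volume.restrict (Set.Ioo (0 : ℝ) 1)),
      ∀ X : Submodule.span ℝ ({A, B} : Set (H →L[ℂ] H)),
        MemSchatten 4 (X : H →L[ℂ] H) ∧ ‖T X‖ = schattenNorm 4 (X : H →L[ℂ] H) := by
  obtain ⟨φ, hφ⟩ := exists_linearMap_schattenNorm hA hB
  let ψ : (ℝ × ℝ) →ₗ[ℝ] (H →L[ℂ] H) :=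
    (LinearMap.fst ℝ ℝ ℝ).smulRight A + (LinearMap.snd ℝ ℝ ℝ).smulRight B
  have hψ : ∀ v, ψ v = v.1 • A + v.2 • B := fun v => rfl
  let ψ' : (ℝ × ℝ) →ₗ[ℝ] Submodule.span ℝ ({A, B} : Set (H →L[ℂ] H)) :=
    ψ.codRestrict _ fun v => Submodule.mem_span_pair.2 ⟨v.1, v.2, rfl⟩
  have hsurj : LinearMap.range ψ' = ⊤ := by
    refine LinearMap.range_eq_top.2 fun X => ?_
    obtain ⟨x, y, hxy⟩ := Submodule.mem_span_pair.1 X.2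
    exact ⟨(x, y), Subtype.ext hxy⟩
  -- `A` and `B` may be dependent, so coefficients are chosen by a linear section of `ψ'`; any
  -- choice works, as `‖φ v‖` depends only on `v.1 • A + v.2 • B`.
  have : Module.Projective ℝ (Submodule.span ℝ ({A, B} : Set (H →L[ℂ] H))) :=
    Module.Projective.of_basis (Module.Basis.ofVectorSpace ℝ _)
  obtain ⟨g, hg⟩ := ψ'.exists_rightInverse_of_surjective hsurj
  refine ⟨φ.comp g, fun X => ?_⟩
  have hX : (X : H →L[ℂ] H) = (g X).1 • A + (g X).2 • B := by
    have h := congrArg Subtype.val (LinearMap.congr_fun hg X)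
    rw [← hψ]
    exact h.symm
  rw [hX]
  exact hφ (g X)
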